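/- Let $d\ge 1$. A chip configuration is a function $\chi:\mathbb Z^d\to\{0,1,2,\dots\}$; it is even (odd) if every vertex $\mathbf v$ with $\chi(\mathbf v)\neq 0$ has even (odd) coordinate sum. Fix an ordering $\mathbf e_0,\dots,\mathbf e_{2d-1}$ of the $2d$ vectors all of whose coordinates are zero except for one, which is $\pm1$. In the $P$-machine (rotor-router) every vertex carries a rotor with a state in $\mathbb Z_{2d}$. A rotor in state $j$ that is fed a chip sends it to the neighbouring vertex in direction $\mathbf e_j$ and changes to state $j+1 \pmod{2d}$. In one time unit, all chips currently on each vertex are fed to the rotor of that vertex, simultaneously for all vertices. Let $\chi_n$ be the initial configuration, $\sigma:\mathbb Z^d\to\mathbb Z_{2d}$ the initial rotor settings, and $\chi_0$ the configuration after $n$ time units of the $P$-machine. Let $S_t(\mathbf v)$ be the probability that a simple random walk of $t$ steps on $\mathbb Z^d$ beginning at the origin ends at $\mathbf v$, and let $$W_t(\mathbf v,\chi)=\sum_{\mathbf w\in\mathbb Z^d}\chi(\mathbf w)\,S_t(\mathbf v-\mathbf w).$$ Thus $W_0(\mathbf v,\chi_0)=\chi_0(\mathbf v)$ is the actual number of chips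 at $\mathbf v$ after $n$ steps of the $P$-machine, and $W_n(\mathbf v,\chi_n)$ is the expected number of chips at $\mathbf v$ after every chip of $\chi_n$ has taken an $n$-step simple random walk. Theorem. For every $d\ge1$ there is a constant $C_d$, depending only on $d$, such that for every ordering of the directions, every even or odd initial configuration $\chi_n$, all initial rotor settings $\sigma$, every $n\ge0$ and every vertex $\mathbf v\in\mathbb Z^d$, $$|W_0(\mathbf v,\chi_0)-W_n(\mathbf v,\chi_n)|<C_d.$$ -/

import Mathlib

/-- The `2d` axis directions of `ℤ^d`: a coordinate together with a sign. -/
abbrev Direction (d : ℕ) : Type := Fin d × ℤˣ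

/-- The unit vector of a direction: all coordinates zero except for one, which is `1` or `-1`. -/
def Direction.vec {d : ℕ} (a : Direction d) : Fin d → ℤ := Pi.single a.1 (a.2 : ℤ)

/-- The law of the position, after `t` steps, of the simple random walk on `ℤ^d` started at the
origin: each step is a uniformly random direction, independent of the past. -/
noncomputable def randomWalk (d : ℕ) [NeZero d] : ℕ → PMF (Fin d → ℤ)
  | 0 => PMF.pure 0
  | t + 1 => (randomWalk d t).bind fun x =>
      (PMF.uniformOfFintype (Direction d)).map fun a => x + a.vec

/-- `walkProb d t v`: the probability that the simple random walk of time `t` beginning at the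
origin ends at `v`. -/
noncomputable def walkProb (d : ℕ) [NeZero d] (t : ℕ) (v : Fin d → ℤ) : ℝ :=
  (randomWalk d t v).toReal

/-- `expectedChips t v χ`: the expected number of chips at `v` after every chip of the
configuration `χ` has performed a simple random walk of `t` steps. -/
noncomputable def expectedChips {d : ℕ} [NeZero d] (t : ℕ) (v : Fin d → ℤ)
    (χ : (Fin d → ℤ) → ℕ) : ℝ :=
  ∑' w : Fin d → ℤ, (χ w : ℝ) * walkProb d t (v - w)

/-- A state of the P-machine on `ℤ^d`: the number of chips and the state of the rotor at each
vertex. -/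
structure PMachine (d : ℕ) where
  chips : (Fin d → ℤ) → ℕ
  rotor : (Fin d → ℤ) → ZMod (2 * d)

/-- One time unit of the P-machine for the ordering `e` of the directions. The chips currently on
a vertex `u` are fed one after the other to the rotor at `u`; the `i`-th of them
(`i = 0, 1, …, chips u - 1`) finds the rotor in state `rotor u + i`, is sent in the direction with
that label, and increases the state by one. This happens at all vertices simultaneously. -/
def PMachine.step {d : ℕ} (e : ZMod (2 * d) ≃ Direction d) (s : PMachine d) : PMachine d where
  chips v := ∑ a : Direction d,
    ((Finset.range (s.chips (v - a.vec))).filter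
      fun i : ℕ => e (s.rotor (v - a.vec) + (i : ZMod (2 * d))) = a).card
  rotor v := s.rotor v + (s.chips v : ZMod (2 * d))

/-- The chip configuration after `n` time units of the P-machine, started from the configuration
`χ` with rotor settings `σ`. -/
def finalChips {d : ℕ} (e : ZMod (2 * d) ≃ Direction d) (χ : (Fin d → ℤ) → ℕ)
    (σ : (Fin d → ℤ) → ZMod (2 * d)) (n : ℕ) : (Fin d → ℤ) → ℕ :=
  ((PMachine.step e)^[n] ⟨χ, σ⟩).chips

/-- All chips are on vertices with even coordinate sum. -/
def IsEvenConfig {d : ℕ} (χ : (Fin d → ℤ) → ℕ) : Prop :=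
  ∀ v ∈ Function.support χ, Even (∑ i, v i)

/-- All chips are on vertices with odd coordinate sum. -/
def IsOddConfig {d : ℕ} (χ : (Fin d → ℤ) → ℕ) : Prop :=
  ∀ v ∈ Function.support χ, Odd (∑ i, v i)

theorem abs_le_of_mem_support_randomWalk {d : ℕ} [NeZero d] (t : ℕ) (v : Fin d → ℤ)
    (hv : v ∈ (randomWalk d t).support) (i : Fin d) : |v i| ≤ t := by
  induction t generalizing v with
  | zero =>
    simp only [randomWalk, PMF.support_pure, Set.mem_singleton_iff] at hv
    simp [hv]
  | succ t ih =>
    simp only [randomWalk, PMF.mem_support_bind_iff, PMF.mem_support_map_iff] at hv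
    obtain ⟨x, hx, a, -, rfl⟩ := hv
    have h1 := ih x hx
    have h2 : |a.vec i| ≤ 1 := by
      unfold Direction.vec
      by_cases h : i = a.1
      · subst h
        rcases Int.units_eq_one_or a.2 with h | h <;> simp [h]
      · simp [Pi.single_eq_of_ne h]
    have h3 := abs_add_le (x i) (a.vec i)
    push_cast
    simp only [Pi.add_apply]
    linarith

/-- The series defining `expectedChips` has only finitely many nonzero terms, whatever the
(possibly infinite) configuration `χ` is. -/
theorem expectedChips_finite {d : ℕ} [NeZero d] (t : ℕ) (v : Fin d → ℤ)
    (χ : (Fin d → ℤ) → ℕ) :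
    (Function.support fun w : Fin d → ℤ => (χ w : ℝ) * walkProb d t (v - w)).Finite := by
  refine (Set.finite_Icc (fun i => v i - t) (fun i => v i + t)).subset ?_
  intro w hw
  have h : v - w ∈ (randomWalk d t).support := by
    rw [PMF.mem_support_iff]
    intro h0
    exact hw (by simp [walkProb, h0])
  have h1 := fun i => abs_le.1 (abs_le_of_mem_support_randomWalk t _ h i)
  simp only [Pi.sub_apply] at h1
  exact ⟨fun i => by have := (h1 i).2; simp only; linarith,
    fun i => by have := (h1 i).1; simp only; linarith⟩

/-- After zero steps the expected number of chips is the actual number of chips. -/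
theorem expectedChips_zero {d : ℕ} [NeZero d] (v : Fin d → ℤ) (χ : (Fin d → ℤ) → ℕ) :
    expectedChips 0 v χ = χ v := by
  unfold expectedChips
  rw [tsum_eq_single v]
  · simp [walkProb, randomWalk]
  · intro w hw
    have : v - w ≠ 0 := fun h => hw (sub_eq_zero.1 h).symm
    simp [walkProb, randomWalk, this]

/-!
Each step of the machine replaces, for every chip, one uniformly random step by a step in the
direction `a` chosen by the rotor. If `t` random steps remain and the chip sits at `u`, this changes
the expected final number of chips at `v` by `influence a t (v - u)`, the value at `v - u` of
`(τ_a - P) * P ^ t` in the group algebra `ℝ[ℤ^d]`, where `τ_a` is the point mass at the unit vector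
of `a` and `P` is the step law. The discrepancy in the theorem is the sum of these influences over
all chips and times (`hasSum_expectedChips_sub`).

Fix a vertex `u`. The influences of the `2d` directions add up to zero, so only the surplus of chips
sent in each direction matters, and the rotor keeps this surplus at most `1` in absolute value.
Moreover `u` is occupied only at times of one parity, because the initial configuration is even or
odd. Summation by parts therefore bounds the contribution of `u` by boundary terms and the two-step
variation of the influence in time (`abs_sum_sentCount_mul_influence_le`). Summed over `u`, the
boundary terms are bounded, and the variation becomes `∑ t, ‖(P ^ 2 - 1) * (τ_a - P) * P ^ t‖₁`.

This series converges because its terms are `O(t ^ (-3/2))` (`l1Norm_sq_sub_one_mul_le`). The `ℓ¹`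
norm is submultiplicative and, by `stepLaw_sq_sub_one`, `P ^ 2 - 1` is an average of products of two
differences `τ_i - τ_j`. So it suffices that `‖(τ_i - τ_j) * P ^ N‖₁ = O(N ^ (-1/2))`. To see this,
weight every path of `N + 1` steps by the number of its `i`-steps minus the number of its `j`-steps:
by exchangeability the weighted sum of the endpoint masses is a multiple of `(τ_i - τ_j) * P ^ N`
(`sum_weight_smul_single`), and the expectation of the absolute value of the weight is
`O(N ^ (1/2))` by the Cauchy-Schwarz inequality, since the weight has variance `O(N)`.
-/

open AddMonoidAlgebra

/-! ### The `ℓ¹` norm on a group algebra -/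

/-- The `ℓ¹` norm of an element of the group algebra `ℝ[G]`, that is, the total variation of the
corresponding finitely supported signed measure. -/
noncomputable def l1Norm {G : Type*} (b : AddMonoidAlgebra ℝ G) : ℝ := b.coeff.sum fun _ c => |c|

section L1Norm

variable {G : Type*}

theorem l1Norm_eq_sum (b : AddMonoidAlgebra ℝ G) {s : Finset G} (hs : b.coeff.support ⊆ s) :
    l1Norm b = ∑ x ∈ s, |b.coeff x| :=
  Finsupp.sum_of_support_subset _ hs _ (by simp)

theorem l1Norm_nonneg (b : AddMonoidAlgebra ℝ G) : 0 ≤ l1Norm b :=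
  Finset.sum_nonneg fun _ _ => abs_nonneg _

@[simp] theorem l1Norm_zero : l1Norm (0 : AddMonoidAlgebra ℝ G) = 0 := by simp [l1Norm]

@[simp] theorem l1Norm_single (x : G) (c : ℝ) :
    l1Norm (single x c : AddMonoidAlgebra ℝ G) = |c| := by
  simp [l1Norm]

theorem l1Norm_add_le (a b : AddMonoidAlgebra ℝ G) : l1Norm (a + b) ≤ l1Norm a + l1Norm b := by
  classical
  rw [l1Norm_eq_sum (a + b) (s := a.coeff.support ∪ b.coeff.support)
      (by rw [coeff_add]; exact Finsupp.support_add),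
    l1Norm_eq_sum a Finset.subset_union_left, l1Norm_eq_sum b Finset.subset_union_right,
    ← Finset.sum_add_distrib]
  exact Finset.sum_le_sum fun x _ => by simpa using abs_add_le _ _

theorem l1Norm_sum_le {κ : Type*} (s : Finset κ) (f : κ → AddMonoidAlgebra ℝ G) :
    l1Norm (∑ k ∈ s, f k) ≤ ∑ k ∈ s, l1Norm (f k) := by
  classical
  induction s using Finset.induction_on with
  | empty => simp
  | insert k s hk ih =>
    rw [Finset.sum_insert hk, Finset.sum_insert hk]
    exact (l1Norm_add_le _ _).trans (by gcongr)

theorem l1Norm_smul (c : ℝ) (b : AddMonoidAlgebra ℝ G) : l1Norm (c • b) = |c| * l1Norm b := by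
  rw [l1Norm_eq_sum (c • b) (s := b.coeff.support)
    (by rw [coeff_smul]; exact Finsupp.support_smul), l1Norm, Finsupp.sum, Finset.mul_sum]
  simp [abs_mul]

theorem l1Norm_mul_le [AddMonoid G] (a b : AddMonoidAlgebra ℝ G) :
    l1Norm (a * b) ≤ l1Norm a * l1Norm b := by
  rw [l1Norm_eq_sum a subset_rfl, l1Norm_eq_sum b subset_rfl, Finset.sum_mul_sum, mul_def,
    Finsupp.sum]
  refine (l1Norm_sum_le _ _).trans (Finset.sum_le_sum fun x _ => ?_)
  refine (l1Norm_sum_le _ _).trans (Finset.sum_le_sum fun y _ => ?_)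
  simp [abs_mul]

theorem l1Norm_pow_le_one [AddMonoid G] {a : AddMonoidAlgebra ℝ G} (ha : l1Norm a ≤ 1) (N : ℕ) :
    l1Norm (a ^ N) ≤ 1 := by
  induction N with
  | zero => simp [one_def]
  | succ N ih =>
    rw [pow_succ]
    exact (l1Norm_mul_le _ _).trans (mul_le_one₀ ih (l1Norm_nonneg _) ha)

/-- The values of an element of the group algebra, summed along a reflected and translated copy
of the group, are absolutely summable with sum the `ℓ¹` norm. -/
theorem hasSum_abs_coeff_sub [AddCommGroup G] (b : AddMonoidAlgebra ℝ G) (v : G) :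
    HasSum (fun u => |b.coeff (v - u)|) (l1Norm b) := by
  refine (Equiv.subLeft v).hasSum_iff (f := fun x => |b.coeff x|) |>.2 ?_
  exact hasSum_sum_of_ne_finset_zero fun x hx => by simpa using hx

end L1Norm

/-! ### Weighted sums over paths -/

section Increments

variable {G ι : Type*} [AddCommGroup G] [Fintype ι]

theorem sum_fin_succ_fun {M : Type*} [AddCommMonoid M] (N : ℕ) (F : (Fin (N + 1) → ι) → M) :
    ∑ ω, F ω = ∑ k, ∑ ω : Fin N → ι, F (Fin.cons k ω) := by
  rw [← Fintype.sum_prod_type']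
  exact (Fintype.sum_equiv (Fin.consEquiv fun _ => ι) _ _ fun _ => rfl).symm

/-- The sum of the point masses at the possible increments of a walk. -/
noncomputable def stepSum (v : ι → G) : AddMonoidAlgebra ℝ G := ∑ k, single (v k) 1

theorem stepSum_pow (v : ι → G) (N : ℕ) :
    stepSum v ^ N = ∑ ω : Fin N → ι, single (∑ s, v (ω s)) 1 := by
  induction N with
  | zero => simp [one_def]
  | succ N ih =>
    rw [sum_fin_succ_fun, pow_succ', ih, stepSum, Finset.sum_mul_sum]
    simp [Fin.sum_univ_succ, single_mul_single]

/-- Weighting each path by the additive functional `∑ ξ (ω s)` turns the law of the endpoint into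
a multiple of the weighted increment `∑ ξ k • δ_{v k}` convolved with a shorter walk. -/
theorem sum_weight_smul_single (v : ι → G) (ξ : ι → ℝ) (N : ℕ) :
    ∑ ω : Fin (N + 1) → ι, (∑ s, ξ (ω s)) • (single (∑ s, v (ω s)) 1 : AddMonoidAlgebra ℝ G)
      = (N + 1 : ℝ) • ((∑ k, ξ k • single (v k) 1) * stepSum v ^ N) := by
  have rec_formula (N : ℕ) : ∑ ω : Fin (N + 1) → ι,
      (∑ s, ξ (ω s)) • (single (∑ s, v (ω s)) 1 : AddMonoidAlgebra ℝ G)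
      = (∑ k, ξ k • single (v k) 1) * stepSum v ^ N + stepSum v *
        ∑ ω : Fin N → ι, (∑ s, ξ (ω s)) • single (∑ s, v (ω s)) 1 := by
    rw [sum_fin_succ_fun, stepSum_pow, stepSum, Finset.sum_mul_sum, Finset.sum_mul_sum,
      ← Finset.sum_add_distrib]
    refine Finset.sum_congr rfl fun k _ => ?_
    rw [← Finset.sum_add_distrib]
    refine Finset.sum_congr rfl fun ω _ => ?_
    simp [Fin.sum_univ_succ, single_mul_single, ← single_add]
  induction N with
  | zero => rw [rec_formula]; simp
  | succ N ih =>
    rw [rec_formula, ih, mul_smul_comm, pow_succ']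
    push_cast
    rw [mul_left_comm (stepSum v)]
    module

theorem sum_weight_eq_zero {ξ : ι → ℝ} (hξ : ∑ k, ξ k = 0) (N : ℕ) :
    ∑ ω : Fin N → ι, ∑ s, ξ (ω s) = 0 := by
  induction N with
  | zero => simp
  | succ N ih =>
    rw [sum_fin_succ_fun]
    simp [Fin.sum_univ_succ, Finset.sum_add_distrib, ih, ← Finset.mul_sum, hξ]

/-- The variance of a sum of `N` independent centred increments is `N` times the variance of one
of them. -/
theorem sum_weight_sq {ξ : ι → ℝ} (hξ : ∑ k, ξ k = 0) (N : ℕ) :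
    ∑ ω : Fin (N + 1) → ι, (∑ s, ξ (ω s)) ^ 2
      = (N + 1) * (∑ k, ξ k ^ 2) * (Fintype.card ι : ℝ) ^ N := by
  have rec_formula (N : ℕ) : ∑ ω : Fin (N + 1) → ι, (∑ s, ξ (ω s)) ^ 2
      = (∑ k, ξ k ^ 2) * (Fintype.card ι : ℝ) ^ N
        + Fintype.card ι * ∑ ω : Fin N → ι, (∑ s, ξ (ω s)) ^ 2 := by
    rw [sum_fin_succ_fun]
    simp only [Fin.sum_univ_succ, Fin.cons_zero, Fin.cons_succ, add_sq, Finset.sum_add_distrib,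
      ← Finset.mul_sum, sum_weight_eq_zero hξ]
    simp [← Finset.mul_sum, mul_comm]
  induction N with
  | zero => rw [rec_formula]; simp
  | succ N ih =>
    rw [rec_formula, ih]
    push_cast
    ring

theorem l1Norm_weight_mul_stepSum_pow_le (v : ι → G) {ξ : ι → ℝ} (hξ : ∑ k, ξ k = 0) (N : ℕ) :
    l1Norm ((∑ k, ξ k • single (v k) 1) * stepSum v ^ N)
      ≤ √(Fintype.card ι * ∑ k, ξ k ^ 2) / √(N + 1) * (Fintype.card ι : ℝ) ^ N := by
  set X := l1Norm ((∑ k, ξ k • single (v k) 1) * stepSum v ^ N)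
  set n : ℝ := (Fintype.card ι : ℝ)
  set q := ∑ k, ξ k ^ 2
  have hN : (0 : ℝ) < N + 1 := by positivity
  have h1 : (N + 1) * X ≤ ∑ ω : Fin (N + 1) → ι, |∑ s, ξ (ω s)| := by
    have := l1Norm_sum_le Finset.univ fun ω : Fin (N + 1) → ι =>
      (∑ s, ξ (ω s)) • (single (∑ s, v (ω s)) 1 : AddMonoidAlgebra ℝ G)
    rw [sum_weight_smul_single, l1Norm_smul, abs_of_pos hN] at this
    simpa only [l1Norm_smul, l1Norm_single, abs_one, mul_one] using this
  have h2 : (∑ ω : Fin (N + 1) → ι, |∑ s, ξ (ω s)|) ^ 2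
      ≤ n ^ (N + 1) * ((N + 1) * q * n ^ N) := by
    have := sq_sum_le_card_mul_sum_sq (s := Finset.univ)
      (f := fun ω : Fin (N + 1) → ι => |∑ s, ξ (ω s)|)
    simpa [sum_weight_sq hξ] using this
  have hX : 0 ≤ X := l1Norm_nonneg _
  have h3 : ((N + 1) * X) ^ 2 ≤ n ^ (N + 1) * ((N + 1) * q * n ^ N) :=
    (pow_le_pow_left₀ (by positivity) h1 2).trans h2
  rw [← Real.sqrt_div' _ hN.le]
  refine abs_le_of_sq_le_sq' ?_ (by positivity) |>.2
  rw [mul_pow, Real.sq_sqrt (by positivity), div_mul_eq_mul_div, le_div_iff₀ hN]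
  refine le_of_mul_le_mul_left ?_ hN
  calc _ = ((N + 1) * X) ^ 2 := by ring
    _ ≤ _ := h3
    _ = _ := by ring

end Increments

/-! ### Decay of differences of the law of a random walk -/

section Smoothing

variable {G ι : Type*} [AddCommGroup G] [Fintype ι]

/-- The uniform probability measure on the increments `v k`, as an element of the group algebra;
its powers are the laws of the random walk with these increments. -/
noncomputable def stepLaw (v : ι → G) : AddMonoidAlgebra ℝ G :=
  (Fintype.card ι : ℝ)⁻¹ • stepSum v

theorem l1Norm_stepLaw_le (v : ι → G) : l1Norm (stepLaw v) ≤ 1 := by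
  have h : l1Norm (stepSum v) ≤ Fintype.card ι := by
    refine (l1Norm_sum_le _ _).trans ?_
    simp
  rw [stepLaw, l1Norm_smul, abs_of_nonneg (by positivity)]
  exact (mul_le_mul_of_nonneg_left h (by positivity)).trans (inv_mul_le_one)

variable [Nonempty ι]

/-- Two walks of `N` steps started from neighbours of a common vertex have laws at distance
`O(N ^ (-1/2))`. -/
theorem l1Norm_sub_mul_stepLaw_pow_le (v : ι → G) (i j : ι) (N : ℕ) :
    l1Norm ((single (v i) 1 - single (v j) 1) * stepLaw v ^ N)
      ≤ 2 * √(Fintype.card ι) / √(N + 1) := by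
  classical
  set n : ℝ := (Fintype.card ι : ℝ) with hn
  have hn0 : 0 < n := by simp [hn, Fintype.card_pos]
  set ξ : ι → ℝ := Pi.single i 1 - Pi.single j 1 with hξ
  have h0 : ∑ k, ξ k = 0 := by simp [hξ]
  have h1 : ∑ k, ξ k ^ 2 ≤ 4 := by
    have h (k : ι) : ξ k ^ 2 ≤ 2 * (Pi.single i (1 : ℝ) : ι → ℝ) k
        + 2 * (Pi.single j (1 : ℝ) : ι → ℝ) k := by
      simp only [hξ, Pi.sub_apply, Pi.single_apply]
      split_ifs <;> norm_num
    refine (Finset.sum_le_sum fun k _ => h k).trans ?_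
    rw [Finset.sum_add_distrib, ← Finset.mul_sum, ← Finset.mul_sum]
    simp
    norm_num
  have h2 : (single (v i) 1 - single (v j) 1 : AddMonoidAlgebra ℝ G)
      = ∑ k, ξ k • single (v k) 1 := by
    simp only [hξ, Pi.sub_apply, sub_smul, Finset.sum_sub_distrib, Pi.single_apply, ite_smul,
      one_smul, zero_smul, Finset.sum_ite_eq', Finset.mem_univ, if_true]
  rw [h2, stepLaw, smul_pow, mul_smul_comm, l1Norm_smul, abs_of_nonneg (by positivity)]
  have h3 := l1Norm_weight_mul_stepSum_pow_le v h0 N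
  have h4 : √(n * ∑ k, ξ k ^ 2) ≤ 2 * √n := by
    rw [show 2 * √n = √(n * 4) by
      rw [Real.sqrt_mul hn0.le, show (4 : ℝ) = 2 ^ 2 by norm_num, Real.sqrt_sq (by norm_num),
        mul_comm]]
    gcongr
  calc n⁻¹ ^ N * _ ≤ n⁻¹ ^ N * (√(n * ∑ k, ξ k ^ 2) / √(N + 1) * n ^ N) := by gcongr
    _ = √(n * ∑ k, ξ k ^ 2) / √(N + 1) := by
      rw [mul_left_comm, ← mul_pow, inv_mul_cancel₀ hn0.ne', one_pow, mul_one]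
    _ ≤ _ := by gcongr

theorem l1Norm_sub_stepLaw_mul_pow_le (v : ι → G) (i : ι) (N : ℕ) :
    l1Norm ((single (v i) 1 - stepLaw v) * stepLaw v ^ N)
      ≤ 2 * √(Fintype.card ι) / √(N + 1) := by
  have hn0 : (Fintype.card ι : ℝ) ≠ 0 := by simp
  have h : (single (v i) 1 - stepLaw v) * stepLaw v ^ N
      = (Fintype.card ι : ℝ)⁻¹ • ∑ k, (single (v i) 1 - single (v k) 1) * stepLaw v ^ N := by
    rw [← Finset.sum_mul, Finset.sum_sub_distrib, ← smul_mul_assoc, smul_sub, Finset.sum_const,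
      Finset.card_univ, ← Nat.cast_smul_eq_nsmul ℝ, inv_smul_smul₀ hn0]
    rfl
  rw [h, l1Norm_smul, abs_of_nonneg (by positivity)]
  calc _ ≤ (Fintype.card ι : ℝ)⁻¹ * ∑ _k : ι, (2 * √(Fintype.card ι) / √(N + 1)) := by
        gcongr
        exact (l1Norm_sum_le _ _).trans
          (Finset.sum_le_sum fun k _ => l1Norm_sub_mul_stepLaw_pow_le v i k N)
    _ = _ := by rw [Finset.sum_const, Finset.card_univ, nsmul_eq_mul, inv_mul_cancel_left₀ hn0]

/-- For a symmetric set of increments, the two-step difference operator is an average of products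
of two differences of increments. This is what makes it gain a full factor `N⁻¹`. -/
theorem stepLaw_sq_sub_one (v : ι → G) (op : Equiv.Perm ι) (hop : ∀ k, v (op k) = -v k) :
    stepLaw v ^ 2 - 1 = (2 * (Fintype.card ι : ℝ) ^ 2)⁻¹ • ∑ i, ∑ k,
      (single (v i) 1 - single (v (op k)) 1) * (single (v k) 1 - single (v (op i)) 1) := by
  have hn0 : (Fintype.card ι : ℝ) ≠ 0 := by simp
  have hsum : ∑ k, single (v (op k)) 1 = stepSum v :=
    Equiv.sum_comp op fun k => (single (v k) 1 : AddMonoidAlgebra ℝ G)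
  have h (i k : ι) : (single (v i) 1 - single (v (op k)) 1 : AddMonoidAlgebra ℝ G)
      * (single (v k) 1 - single (v (op i)) 1)
      = single (v i) 1 * single (v k) 1 + single (v (op i)) 1 * single (v (op k)) 1
        - (2 : ℝ) • 1 := by
    have h1 (l : ι) : (single (v l) 1 * single (v (op l)) 1 : AddMonoidAlgebra ℝ G) = 1 := by
      simp [single_mul_single, hop, one_def]
    rw [two_smul]
    linear_combination (norm := ring) -h1 i - h1 k
  simp only [h, Finset.sum_sub_distrib, Finset.sum_add_distrib, ← Finset.mul_sum,
    ← Finset.sum_mul, hsum, Finset.sum_const, Finset.card_univ, ← Nat.cast_smul_eq_nsmul ℝ]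
  rw [stepLaw, smul_pow, ← stepSum, ← pow_two]
  match_scalars <;> field_simp
  ring

/-- The two-step time difference of the gradient of the law of the walk has `ℓ¹` norm
`O(T ^ (-3/2))`, which is summable in `T`: split the `T` steps into three parts of equal length and
let each of the three difference factors act on one of them. -/
theorem l1Norm_sq_sub_one_mul_le (v : ι → G) (op : Equiv.Perm ι) (hop : ∀ k, v (op k) = -v k)
    (a : ι) (T : ℕ) :
    l1Norm ((stepLaw v ^ 2 - 1) * (single (v a) 1 - stepLaw v) * stepLaw v ^ T)
      ≤ 4 * √(3 * Fintype.card ι) ^ 3 / √(T + 1) ^ 3 := by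
  have hn0 : (Fintype.card ι : ℝ) ≠ 0 := by simp
  set m := T / 3 with hm
  set r := T % 3 with hr
  set c := 2 * √(Fintype.card ι) / √(m + 1) with hc
  have hc0 : 0 ≤ c := by positivity
  have hT : stepLaw v ^ T = stepLaw v ^ m * stepLaw v ^ m * stepLaw v ^ m * stepLaw v ^ r := by
    rw [← pow_add, ← pow_add, ← pow_add]
    congr 1
    omega
  have key : (stepLaw v ^ 2 - 1) * (single (v a) 1 - stepLaw v) * stepLaw v ^ T
      = (2 * (Fintype.card ι : ℝ) ^ 2)⁻¹ • ∑ i, ∑ k,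
        ((single (v i) 1 - single (v (op k)) 1) * stepLaw v ^ m) *
        ((single (v k) 1 - single (v (op i)) 1) * stepLaw v ^ m) *
        ((single (v a) 1 - stepLaw v) * stepLaw v ^ m) * stepLaw v ^ r := by
    rw [stepLaw_sq_sub_one v op hop, smul_mul_assoc, smul_mul_assoc, Finset.sum_mul,
      Finset.sum_mul]
    congr 1
    refine Finset.sum_congr rfl fun i _ => ?_
    rw [Finset.sum_mul, Finset.sum_mul]
    refine Finset.sum_congr rfl fun k _ => ?_
    rw [hT]
    ring
  have term (i k : ι) : l1Norm (((single (v i) 1 - single (v (op k)) 1) * stepLaw v ^ m) *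
        ((single (v k) 1 - single (v (op i)) 1) * stepLaw v ^ m) *
        ((single (v a) 1 - stepLaw v) * stepLaw v ^ m) * stepLaw v ^ r) ≤ c ^ 3 := by
    calc _ ≤ c * c * c * 1 := by
          refine (l1Norm_mul_le _ _).trans (mul_le_mul ((l1Norm_mul_le _ _).trans
            (mul_le_mul ((l1Norm_mul_le _ _).trans (mul_le_mul ?_ ?_ (l1Norm_nonneg _) hc0)) ?_
              (l1Norm_nonneg _) (by positivity)))
            (l1Norm_pow_le_one (l1Norm_stepLaw_le v) r) (l1Norm_nonneg _) (by positivity))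
          · exact l1Norm_sub_mul_stepLaw_pow_le ..
          · exact l1Norm_sub_mul_stepLaw_pow_le ..
          · exact l1Norm_sub_stepLaw_mul_pow_le ..
      _ = c ^ 3 := by ring
  have hcT : c ≤ 2 * √(3 * Fintype.card ι) / √(T + 1) := by
    have h : √((T : ℝ) + 1) ≤ √3 * √(m + 1) := by
      rw [← Real.sqrt_mul (by norm_num)]
      have : T + 1 ≤ 3 * (m + 1) := by omega
      exact Real.sqrt_le_sqrt (by exact_mod_cast this)
    rw [hc, Real.sqrt_mul (by norm_num), div_le_div_iff₀ (by positivity) (by positivity)]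
    calc _ ≤ 2 * √(Fintype.card ι) * (√3 * √(m + 1)) := by gcongr
      _ = _ := by ring
  rw [key, l1Norm_smul, abs_of_nonneg (by positivity)]
  calc _ ≤ (2 * (Fintype.card ι : ℝ) ^ 2)⁻¹ * ∑ _i : ι, ∑ _k : ι, c ^ 3 := by
        gcongr
        refine (l1Norm_sum_le _ _).trans (Finset.sum_le_sum fun i _ => ?_)
        exact (l1Norm_sum_le _ _).trans (Finset.sum_le_sum fun k _ => term i k)
    _ = c ^ 3 / 2 := by
      simp only [Finset.sum_const, Finset.card_univ, nsmul_eq_mul]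
      field_simp
    _ ≤ (2 * √(3 * Fintype.card ι) / √(T + 1)) ^ 3 / 2 := by gcongr
    _ = _ := by ring

theorem summable_one_div_sqrt_cube : Summable fun T : ℕ => 1 / √((T : ℝ) + 1) ^ 3 := by
  have h := (summable_nat_add_iff 1).2
    (Real.summable_one_div_nat_rpow (p := 3 / 2) |>.2 (by norm_num))
  refine h.congr fun T => ?_
  rw [Real.sqrt_eq_rpow, ← Real.rpow_natCast, ← Real.rpow_mul (by positivity)]
  norm_num

end Smoothing

/-! ### Summation by parts -/

section SummationByParts

theorem abs_sum_sub_mul_le {g : ℕ → ℝ} (hg : ∀ m, |g m| ≤ 1) (h : ℕ → ℝ) (n : ℕ) :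
    |∑ m ∈ Finset.range (n + 1), (g (m + 1) - g m) * h m|
      ≤ |h n| + |h 0| + ∑ m ∈ Finset.range n, |h (m + 1) - h m| := by
  have mul_le (m : ℕ) (x : ℝ) : |g m * x| ≤ |x| := by
    rw [abs_mul]
    exact mul_le_of_le_one_left (abs_nonneg _) (hg m)
  have key : |∑ m ∈ Finset.range (n + 1), (g (m + 1) - g m) * h m - g (n + 1) * h n|
      ≤ |h 0| + ∑ m ∈ Finset.range n, |h (m + 1) - h m| := by
    induction n with
    | zero =>
      have := mul_le 0 (h 0)
      rw [← abs_neg] at this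
      simpa [sub_mul] using this
    | succ n ih =>
      rw [Finset.sum_range_succ, Finset.sum_range_succ (fun m => |h (m + 1) - h m|),
        show ∑ m ∈ Finset.range (n + 1), (g (m + 1) - g m) * h m
            + (g (n + 1 + 1) - g (n + 1)) * h (n + 1) - g (n + 1 + 1) * h (n + 1)
          = (∑ m ∈ Finset.range (n + 1), (g (m + 1) - g m) * h m - g (n + 1) * h n)
            - g (n + 1) * (h (n + 1) - h n) by ring]
      have h1 := abs_sub (∑ m ∈ Finset.range (n + 1), (g (m + 1) - g m) * h m - g (n + 1) * h n)
        (g (n + 1) * (h (n + 1) - h n))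
      linarith [mul_le (n + 1) (h (n + 1) - h n)]
  have h1 := abs_add_le
    (∑ m ∈ Finset.range (n + 1), (g (m + 1) - g m) * h m - g (n + 1) * h n) (g (n + 1) * h n)
  rw [sub_add_cancel] at h1
  linarith [mul_le (n + 1) (h n)]

/-- Summation by parts when the increments of `g` vanish at every other time: only the variation
of `h` along times of equal parity matters. -/
theorem abs_sum_sub_mul_le_of_alternate {g : ℕ → ℝ} (hg : ∀ m, |g m| ≤ 1) {A : ℕ → Prop}
    (hA : ∀ m, A (m + 1) ↔ ¬A m) (hgA : ∀ m, ¬A m → g (m + 1) = g m) (h : ℕ → ℝ) (n : ℕ) :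
    |∑ m ∈ Finset.range (n + 1), (g (m + 1) - g m) * h m|
      ≤ |h n| + |h (n - 1)| + 2 * |h 0| + |h 1|
        + ∑ m ∈ Finset.range (n - 1), |h (m + 2) - h m| := by
  classical
  -- The values of `h` at inactive times are irrelevant, so they may be replaced by the value at
  -- the preceding active time.
  set k : ℕ → ℝ := fun m => if A m then h m else h (m - 1) with hk
  have h1 : ∑ m ∈ Finset.range (n + 1), (g (m + 1) - g m) * h m
      = ∑ m ∈ Finset.range (n + 1), (g (m + 1) - g m) * k m := by
    refine Finset.sum_congr rfl fun m _ => ?_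
    by_cases hm : A m
    · simp [hk, hm]
    · simp [hgA m hm]
  have h2 (m : ℕ) : |k m| ≤ |h m| + |h (m - 1)| := by
    simp only [hk]
    split_ifs
    · linarith [abs_nonneg (h (m - 1))]
    · linarith [abs_nonneg (h m)]
  have h3 : |k 0| = |h 0| := by simp [hk]
  have h4 (m : ℕ) : |k (m + 2) - k (m + 1)| ≤ |h (m + 2) - h m| := by
    by_cases hm : A (m + 1)
    · have hm2 : ¬A (m + 2) := fun h => (hA (m + 1)).1 h hm
      simp [hk, hm, hm2]
    · have hm2 : A (m + 2) := (hA (m + 1)).2 hm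
      simp [hk, hm, hm2]
  have h5 : |k 1 - k 0| ≤ |h 1| + |h 0| := by
    by_cases hm : A 1
    · simpa [hk, hm] using abs_sub (h 1) (h 0)
    · simp only [hk, hm, if_false]
      simp
      positivity
  have h6 : ∑ m ∈ Finset.range n, |k (m + 1) - k m|
      ≤ |h 1| + |h 0| + ∑ m ∈ Finset.range (n - 1), |h (m + 2) - h m| := by
    cases n with
    | zero => simp; positivity
    | succ n =>
      rw [Finset.sum_range_succ', add_comm]
      exact add_le_add h5 (Finset.sum_le_sum fun m _ => h4 m)
  rw [h1]
  linarith [abs_sum_sub_mul_le hg k n, h2 n]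

end SummationByParts

/-! ### The simple random walk -/

section Walk

variable {d : ℕ}

theorem Direction.vec_neg (a : Direction d) : Direction.vec (a.1, -a.2) = -a.vec := by
  simp [Direction.vec, Pi.single_neg]

theorem Direction.odd_sum_vec (a : Direction d) : Odd (∑ i, a.vec i) := by
  rw [Direction.vec, Finset.sum_pi_single']
  rcases Int.units_eq_one_or a.2 with h | h <;> simp [h]

/-- The reversal of directions. -/
def Direction.reverse : Equiv.Perm (Direction d) := Equiv.prodCongrRight fun _ => Equiv.neg ℤˣ

theorem Direction.vec_reverse (a : Direction d) : (Direction.reverse a).vec = -a.vec :=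
  Direction.vec_neg a

theorem walkProb_succ [NeZero d] (t : ℕ) (v : Fin d → ℤ) :
    walkProb d (t + 1) v
      = (Fintype.card (Direction d) : ℝ)⁻¹ * ∑ a : Direction d, walkProb d t (v - a.vec) := by
  have h1 : randomWalk d (t + 1) = (PMF.uniformOfFintype (Direction d)).bind fun a =>
      (randomWalk d t).map fun x => x + a.vec := by
    simp only [randomWalk, PMF.map]
    exact PMF.bind_comm _ _ _
  have h2 (a : Direction d) : ((randomWalk d t).map fun x => x + a.vec) v
      = randomWalk d t (v - a.vec) := by
    rw [PMF.map_apply, tsum_eq_single (v - a.vec)]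
    · simp
    · intro x hx
      rw [if_neg]
      rintro rfl
      simp at hx
  rw [walkProb, h1, PMF.bind_apply, tsum_fintype,
    ENNReal.toReal_sum fun a _ => ENNReal.mul_ne_top (PMF.apply_ne_top _ _) (PMF.apply_ne_top _ _),
    Finset.mul_sum]
  refine Finset.sum_congr rfl fun a _ => ?_
  rw [h2, ENNReal.toReal_mul, PMF.uniformOfFintype_apply, walkProb]
  simp

/-- The law of the simple random walk is a convolution power. -/
theorem walkProb_eq_coeff [NeZero d] (t : ℕ) (v : Fin d → ℤ) :
    walkProb d t v = (stepLaw (Direction.vec (d := d)) ^ t).coeff v := by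
  induction t generalizing v with
  | zero =>
    by_cases h : v = 0
    · simp [walkProb, randomWalk, one_def, h]
    · simp [walkProb, randomWalk, one_def, h]
  | succ t ih =>
    rw [walkProb_succ, pow_succ', stepLaw, smul_mul_assoc, ← stepLaw, stepSum, Finset.sum_mul]
    simp [ih, neg_add_eq_sub]

theorem summable_mul_coeff_sub {G : Type*} [AddCommGroup G] (c : G → ℝ)
    (b : AddMonoidAlgebra ℝ G) (v : G) : Summable fun w => c w * b.coeff (v - w) := by
  refine summable_of_hasFiniteSupport ((b.coeff.support.finite_toSet.image fun x => v - x).subset ?_)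
  intro w hw
  refine ⟨v - w, ?_, by simp⟩
  simpa using right_ne_zero_of_mul hw

theorem hasSum_expectedChips [NeZero d] (t : ℕ) (v : Fin d → ℤ) (χ : (Fin d → ℤ) → ℕ) :
    HasSum (fun w => (χ w : ℝ) * (stepLaw (Direction.vec (d := d)) ^ t).coeff (v - w))
      (expectedChips t v χ) := by
  simp only [expectedChips, walkProb_eq_coeff]
  exact (summable_mul_coeff_sub _ _ _).hasSum

end Walk

/-! ### The P-machine -/

section Rotor

variable {d : ℕ}

/-- The number of the first `N` chips that a rotor in state `r` sends in direction `a`. -/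
def sentCount (e : ZMod (2 * d) ≃ Direction d) (r : ZMod (2 * d)) (a : Direction d) (N : ℕ) : ℕ :=
  N.count fun i : ℕ => e (r + (i : ZMod (2 * d))) = a

theorem sentCount_add (e : ZMod (2 * d) ≃ Direction d) (r : ZMod (2 * d)) (a : Direction d)
    (M N : ℕ) : sentCount e r a (M + N) = sentCount e r a M + sentCount e (r + M) a N := by
  simp [sentCount, Nat.count_add, add_assoc]

theorem sum_sentCount (e : ZMod (2 * d) ≃ Direction d) (r : ZMod (2 * d)) (N : ℕ) :
    ∑ a, sentCount e r a N = N := by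
  simp only [sentCount, Nat.count_eq_card_filter_range]
  rw [← Finset.card_eq_sum_card_fiberwise (fun _ _ => Finset.mem_coe.2 (Finset.mem_univ _)),
    Finset.card_range]

/-- The rotor distributes the chips evenly among the directions, up to an error of one chip. -/
theorem abs_sentCount_sub_div_le [NeZero d] (e : ZMod (2 * d) ≃ Direction d) (r : ZMod (2 * d))
    (a : Direction d) (N : ℕ) : |(sentCount e r a N : ℝ) - N / (2 * d : ℕ)| ≤ 1 := by
  have hd : 0 < 2 * d := Nat.pos_of_ne_zero (NeZero.ne _)
  have h : sentCount e r a N = N.count (· ≡ (e.symm a - r).val [MOD 2 * d]) := by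
    unfold sentCount
    congr 1
    ext i
    rw [← ZMod.natCast_eq_natCast_iff, ZMod.natCast_zmod_val, ← Equiv.eq_symm_apply,
      eq_sub_iff_add_eq, add_comm]
  have hdiv : (N : ℝ) / (2 * d : ℕ) = (N / (2 * d) : ℕ) + (N % (2 * d) : ℕ) / (2 * d : ℕ) := by
    rw [div_eq_iff (by positivity), add_mul, div_mul_cancel₀ _ (by positivity)]
    exact_mod_cast (Nat.div_add_mod' N (2 * d)).symm
  have h0 : (0 : ℝ) ≤ (N % (2 * d) : ℕ) / (2 * d : ℕ) := by positivity
  have h1 : ((N % (2 * d) : ℕ) : ℝ) / (2 * d : ℕ) ≤ 1 :=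
    (div_le_one₀ (by positivity)).2 (by exact_mod_cast (Nat.mod_lt _ hd).le)
  rw [h, Nat.count_modEq_card _ hd, hdiv, abs_le]
  split_ifs <;> push_cast at * <;> constructor <;> linarith

/-- The state of the P-machine after `m` time units. -/
def stateAt (e : ZMod (2 * d) ≃ Direction d) (χ : (Fin d → ℤ) → ℕ)
    (σ : (Fin d → ℤ) → ZMod (2 * d)) (m : ℕ) : PMachine d := (PMachine.step e)^[m] ⟨χ, σ⟩

theorem stateAt_succ (e : ZMod (2 * d) ≃ Direction d) (χ : (Fin d → ℤ) → ℕ)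
    (σ : (Fin d → ℤ) → ZMod (2 * d)) (m : ℕ) :
    stateAt e χ σ (m + 1) = PMachine.step e (stateAt e χ σ m) :=
  Function.iterate_succ_apply' ..

theorem chips_step (e : ZMod (2 * d) ≃ Direction d) (s : PMachine d) (v : Fin d → ℤ) :
    (s.step e).chips v
      = ∑ a, sentCount e (s.rotor (v - a.vec)) a (s.chips (v - a.vec)) := by
  simp [PMachine.step, sentCount, Nat.count_eq_card_filter_range]

theorem rotor_stateAt (e : ZMod (2 * d) ≃ Direction d) (χ : (Fin d → ℤ) → ℕ)
    (σ : (Fin d → ℤ) → ZMod (2 * d)) (m : ℕ) (u : Fin d → ℤ) :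
    (stateAt e χ σ m).rotor u
      = σ u + (∑ k ∈ Finset.range m, (stateAt e χ σ k).chips u : ℕ) := by
  induction m with
  | zero => simp [stateAt]
  | succ m ih =>
    rw [stateAt_succ, Finset.sum_range_succ]
    change (stateAt e χ σ m).rotor u + ((stateAt e χ σ m).chips u : ZMod (2 * d)) = _
    rw [ih]
    push_cast
    rw [add_assoc]

/-- A vertex is occupied only at times of one parity. -/
theorem exists_even_of_chips_ne_zero (e : ZMod (2 * d) ≃ Direction d) {χ : (Fin d → ℤ) → ℕ}
    (hχ : IsEvenConfig χ ∨ IsOddConfig χ) (σ : (Fin d → ℤ) → ZMod (2 * d)) :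
    ∃ q : ℤ, ∀ m u, (stateAt e χ σ m).chips u ≠ 0 → Even ((∑ i, u i) + m + q) := by
  obtain ⟨q, hq⟩ : ∃ q : ℤ, ∀ u, χ u ≠ 0 → Even ((∑ i, u i) + q) := by
    rcases hχ with h | h
    · exact ⟨0, fun u hu => by simpa using h u hu⟩
    · exact ⟨1, fun u hu => (h u hu).add_one⟩
  refine ⟨q, fun m => ?_⟩
  induction m with
  | zero => simpa [stateAt] using hq
  | succ m ih =>
    intro u hu
    rw [stateAt_succ, chips_step] at hu
    obtain ⟨a, -, ha⟩ := Finset.exists_ne_zero_of_sum_ne_zero hu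
    have hc : (stateAt e χ σ m).chips (u - a.vec) ≠ 0 := by
      intro h
      rw [h] at ha
      simp [sentCount] at ha
    have h1 := ih _ hc
    have h2 := a.odd_sum_vec
    simp only [Pi.sub_apply, Finset.sum_sub_distrib] at h1
    push_cast
    rw [show (∑ i, u i) + ((m : ℤ) + 1) + q
      = ((∑ i, u i) - (∑ i, a.vec i) + m + q) + ((∑ i, a.vec i) + 1) by ring]
    exact h1.add h2.add_one

/-- The effect on the value at `x` of the law after `t` further steps when a first step in the
direction `a` replaces a uniformly random one. -/
noncomputable def influence (a : Direction d) (t : ℕ) (x : Fin d → ℤ) : ℝ :=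
  ((single a.vec 1 - stepLaw Direction.vec) * stepLaw Direction.vec ^ t :
    AddMonoidAlgebra ℝ (Fin d → ℤ)).coeff x

theorem sum_influence [NeZero d] (t : ℕ) (x : Fin d → ℤ) :
    ∑ a : Direction d, influence a t x = 0 := by
  have h : ∑ a : Direction d, (single a.vec 1 - stepLaw Direction.vec
      : AddMonoidAlgebra ℝ (Fin d → ℤ)) = 0 := by
    rw [Finset.sum_sub_distrib, Finset.sum_const, Finset.card_univ, ← Nat.cast_smul_eq_nsmul ℝ,
      stepLaw, smul_inv_smul₀ (by simp [NeZero.ne d]), stepSum, sub_self]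
  simp only [influence]
  rw [← Finsupp.finsetSum_apply, ← coeff_sum, ← Finset.sum_mul, h, zero_mul, coeff_zero,
    Finsupp.zero_apply]

theorem hasSum_abs_influence (a : Direction d) (t : ℕ) (v : Fin d → ℤ) :
    HasSum (fun u => |influence a t (v - u)|)
      (l1Norm ((single a.vec 1 - stepLaw Direction.vec) * stepLaw Direction.vec ^ t)) :=
  hasSum_abs_coeff_sub _ v

theorem hasSum_abs_influence_sub (a : Direction d) (t : ℕ) (v : Fin d → ℤ) :
    HasSum (fun u => |influence a (t + 2) (v - u) - influence a t (v - u)|)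
      (l1Norm ((stepLaw Direction.vec ^ 2 - 1) * (single a.vec 1 - stepLaw Direction.vec)
        * stepLaw Direction.vec ^ t)) := by
  convert hasSum_abs_coeff_sub _ v using 3 with u
  rw [influence, influence, ← Finsupp.sub_apply, ← coeff_sub]
  congr 2
  ring

/-- One time unit of the machine changes the expected final number of chips by the total influence
of the directions in which the chips are sent. -/
theorem hasSum_sentCount_mul_influence [NeZero d] (e : ZMod (2 * d) ≃ Direction d)
    (s : PMachine d) (t : ℕ) (v : Fin d → ℤ) :
    HasSum (fun u => ∑ a, (sentCount e (s.rotor u) a (s.chips u) : ℝ) * influence a t (v - u))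
      (expectedChips t v (s.step e).chips - expectedChips (t + 1) v s.chips) := by
  set P : AddMonoidAlgebra ℝ (Fin d → ℤ) := stepLaw Direction.vec with hP
  set c : Direction d → (Fin d → ℤ) → ℝ :=
    fun a u => sentCount e (s.rotor u) a (s.chips u) with hc
  have h1 : HasSum (fun u => ∑ a, c a u * (single a.vec 1 * P ^ t).coeff (v - u))
      (expectedChips t v (s.step e).chips) := by
    have hf (a : Direction d) :
        HasSum (fun u => c a u * (single a.vec 1 * P ^ t).coeff (v - u))
          (∑' w, c a (w - a.vec) * (P ^ t).coeff (v - w)) := by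
      have := (summable_mul_coeff_sub (fun w => c a (w - a.vec)) (P ^ t) v).hasSum
      rw [← (Equiv.addRight a.vec).hasSum_iff] at this
      convert this using 2 with u
      simp only [Function.comp_apply, Equiv.coe_addRight, add_sub_cancel_right,
        coeff_single_mul_apply, one_mul]
      rw [show -a.vec + (v - u) = v - (u + a.vec) by abel]
    have hs : expectedChips t v (s.step e).chips
        = ∑ a, ∑' w, c a (w - a.vec) * (P ^ t).coeff (v - w) := by
      refine (hasSum_expectedChips t v _).unique ?_
      convert hasSum_sum fun a (_ : a ∈ Finset.univ) =>
        (summable_mul_coeff_sub (fun w => c a (w - a.vec)) (P ^ t) v).hasSum using 2 with w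
      rw [chips_step, ← Finset.sum_mul]
      simp [hc, hP]
    rw [hs]
    exact hasSum_sum fun a _ => hf a
  have h2 := hasSum_expectedChips (t + 1) v s.chips
  refine Eq.subst (motive := fun f => HasSum f _) (funext fun u => Eq.symm ?_) (h1.sub h2)
  have h3 : (s.chips u : ℝ) = ∑ a, c a u := by
    simp only [hc]
    exact_mod_cast (sum_sentCount e (s.rotor u) (s.chips u)).symm
  rw [h3, Finset.sum_mul, ← Finset.sum_sub_distrib]
  refine Finset.sum_congr rfl fun a _ => ?_
  rw [influence, sub_mul, ← pow_succ', coeff_sub, Finsupp.sub_apply, mul_sub]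

theorem hasSum_expectedChips_sub [NeZero d] (e : ZMod (2 * d) ≃ Direction d)
    (χ : (Fin d → ℤ) → ℕ) (σ : (Fin d → ℤ) → ZMod (2 * d)) (n : ℕ) (v : Fin d → ℤ) :
    HasSum (fun u => ∑ m ∈ Finset.range (n + 1), ∑ a, (sentCount e ((stateAt e χ σ m).rotor u) a
        ((stateAt e χ σ m).chips u) : ℝ) * influence a (n - m) (v - u))
      (expectedChips 0 v (finalChips e χ σ (n + 1)) - expectedChips (n + 1) v χ) := by
  have h := Finset.sum_range_sub
    (fun m => expectedChips (n + 1 - m) v (stateAt e χ σ m).chips) (n + 1)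
  simp only [Nat.sub_self, Nat.sub_zero] at h
  change _ = expectedChips 0 v (finalChips e χ σ (n + 1)) - expectedChips (n + 1) v χ at h
  rw [← h]
  refine hasSum_sum fun m hm => ?_
  have hm' : m ≤ n := Nat.lt_succ_iff.1 (Finset.mem_range.1 hm)
  rw [Nat.add_sub_add_right, stateAt_succ, Nat.sub_add_comm hm']
  exact hasSum_sentCount_mul_influence e (stateAt e χ σ m) (n - m) v

/-- The contribution of a single vertex is controlled by the influence at the first two and the
last two times and by its two-step variation in time, since the surplus of chips sent in a given
direction never exceeds one. The subtractions are truncated: for `n = 0` the four times coincide. -/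
theorem abs_sum_sentCount_mul_influence_le [NeZero d] (e : ZMod (2 * d) ≃ Direction d)
    {χ : (Fin d → ℤ) → ℕ} (hχ : IsEvenConfig χ ∨ IsOddConfig χ)
    (σ : (Fin d → ℤ) → ZMod (2 * d)) (n : ℕ) (u x : Fin d → ℤ) :
    |∑ m ∈ Finset.range (n + 1), ∑ a, (sentCount e ((stateAt e χ σ m).rotor u) a
        ((stateAt e χ σ m).chips u) : ℝ) * influence a (n - m) x|
      ≤ ∑ a : Direction d, (|influence a 0 x| + |influence a (n - (n - 1)) x|
        + 2 * |influence a n x| + |influence a (n - 1) x|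
        + ∑ t ∈ Finset.range (n - 1), |influence a (t + 2) x - influence a t x|) := by
  set c : ℕ → ℕ := fun m => (stateAt e χ σ m).chips u with hc
  set N : ℕ → ℕ := fun m => ∑ k ∈ Finset.range m, c k with hN
  set g : Direction d → ℕ → ℝ :=
    fun a m => (sentCount e (σ u) a (N m) : ℝ) - N m / (2 * d : ℕ) with hg
  obtain ⟨q, hq⟩ := exists_even_of_chips_ne_zero e hχ σ
  have hNs (m : ℕ) : N (m + 1) = N m + c m := Finset.sum_range_succ ..
  have hgs (a : Direction d) (m : ℕ) : g a (m + 1) - g a m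
      = sentCount e ((stateAt e χ σ m).rotor u) a (c m) - c m / (2 * d : ℕ) := by
    rw [show (stateAt e χ σ m).rotor u = σ u + (N m : ℕ) from rotor_stateAt ..]
    simp only [hg, hNs, sentCount_add]
    push_cast
    ring
  have h1 : ∑ m ∈ Finset.range (n + 1), ∑ a, (sentCount e ((stateAt e χ σ m).rotor u) a
        (c m) : ℝ) * influence a (n - m) x
      = ∑ a, ∑ m ∈ Finset.range (n + 1), (g a (m + 1) - g a m) * influence a (n - m) x := by
    symm
    rw [Finset.sum_comm]
    refine Finset.sum_congr rfl fun m _ => ?_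
    simp only [hgs, sub_mul, Finset.sum_sub_distrib, ← Finset.mul_sum, sum_influence]
    simp
  rw [h1]
  refine (Finset.abs_sum_le_sum_abs _ _).trans (Finset.sum_le_sum fun a _ => ?_)
  have h2 := abs_sum_sub_mul_le_of_alternate (g := g a)
    (fun m => abs_sentCount_sub_div_le e (σ u) a (N m))
    (A := fun m => Even ((∑ i, u i) + m + q))
    (fun m => by push_cast; rw [← add_assoc, add_right_comm, Int.even_add_one])
    (fun m hm => by
      have : c m = 0 := by
        by_contra h
        exact hm (hq m u h)
      simp [hg, hNs, this])
    (fun m => influence a (n - m) x) n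
  have h3 : ∑ m ∈ Finset.range (n - 1),
        |influence a (n - (m + 2)) x - influence a (n - m) x|
      = ∑ t ∈ Finset.range (n - 1), |influence a (t + 2) x - influence a t x| := by
    rw [← Finset.sum_range_reflect]
    refine Finset.sum_congr rfl fun t ht => ?_
    have := Finset.mem_range.1 ht
    rw [abs_sub_comm]
    congr 3 <;> omega
  rw [h3] at h2
  simpa using h2

theorem theorem1 (d : ℕ) [NeZero d] :
    ∃ C : ℝ, ∀ (e : ZMod (2 * d) ≃ Direction d)
      (χ : (Fin d → ℤ) → ℕ) (_ : IsEvenConfig χ ∨ IsOddConfig χ)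
      (σ : (Fin d → ℤ) → ZMod (2 * d)) (n : ℕ) (v : Fin d → ℤ),
      |expectedChips 0 v (finalChips e χ σ n) - expectedChips n v χ| < C := by
  set D : ℝ := (Fintype.card (Direction d) : ℝ) with hD
  set K : ℝ := 4 * √(3 * D) ^ 3 with hK
  set Z : ℝ := ∑' T : ℕ, 1 / √((T : ℝ) + 1) ^ 3 with hZ
  have hZ0 : 0 ≤ Z := tsum_nonneg fun T => by positivity
  refine ⟨D * (5 * (2 * √D) + K * Z) + 1, fun e χ hχ σ n v => ?_⟩
  obtain _ | n := n
  · simp only [finalChips, Function.iterate_zero, id_eq, sub_self, abs_zero]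
    have : 0 ≤ D * (5 * (2 * √D) + K * Z) := by positivity
    linarith
  have hg (a : Direction d) (t : ℕ) := (hasSum_abs_influence a t v)
  have hsum : HasSum (fun u => ∑ a : Direction d,
      (|influence a 0 (v - u)| + |influence a (n - (n - 1)) (v - u)|
        + 2 * |influence a n (v - u)| + |influence a (n - 1) (v - u)|
        + ∑ t ∈ Finset.range (n - 1), |influence a (t + 2) (v - u) - influence a t (v - u)|)) _ :=
    hasSum_sum fun a _ => ((((hg a 0).add (hg a (n - (n - 1)))).add ((hg a n).mul_left 2)).add
      (hg a (n - 1))).add (hasSum_sum fun t _ => hasSum_abs_influence_sub a t v)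
  have hbound := tsum_of_norm_bounded hsum fun u =>
    (Real.norm_eq_abs _).trans_le (abs_sum_sentCount_mul_influence_le e hχ σ n u (v - u))
  rw [(hasSum_expectedChips_sub e χ σ n v).tsum_eq, Real.norm_eq_abs] at hbound
  refine lt_of_le_of_lt hbound (lt_add_of_le_of_pos ?_ one_pos)
  have h1 (a : Direction d) (t : ℕ) : l1Norm ((single a.vec 1 - stepLaw Direction.vec)
      * stepLaw Direction.vec ^ t) ≤ 2 * √D := by
    refine (l1Norm_sub_stepLaw_mul_pow_le Direction.vec a t).trans (div_le_self (by positivity) ?_)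
    rw [Real.one_le_sqrt]
    linarith [t.cast_nonneg (α := ℝ)]
  have h2 (a : Direction d) : ∑ t ∈ Finset.range (n - 1), l1Norm ((stepLaw Direction.vec ^ 2 - 1)
      * (single a.vec 1 - stepLaw Direction.vec) * stepLaw Direction.vec ^ t) ≤ K * Z := by
    calc _ ≤ ∑ t ∈ Finset.range (n - 1), K * (1 / √((t : ℝ) + 1) ^ 3) :=
          Finset.sum_le_sum fun t _ => by
            rw [mul_one_div]
            exact l1Norm_sq_sub_one_mul_le Direction.vec Direction.reverse
              Direction.vec_reverse a t
      _ ≤ K * Z := by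
        rw [← Finset.mul_sum]
        gcongr
        exact summable_one_div_sqrt_cube.sum_le_tsum _ fun t _ => by positivity
  calc _ ≤ ∑ _a : Direction d, (5 * (2 * √D) + K * Z) := Finset.sum_le_sum fun a _ => by
        linarith [h1 a 0, h1 a (n - (n - 1)), h1 a n, h1 a (n - 1), h2 a]
    _ = _ := by rw [Finset.sum_const, Finset.card_univ, nsmul_eq_mul]

end Rotor
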